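/- **Setting.** Let $(X,d)$ be an infinite compact ultrametric space; balls are closed balls of positive radius, and a ball is *proper* if it is not all of $X$. A *similarity structure* $\mathrm{Sim}$ on $X$ assigns to any two balls $B_1,B_2$ a set $\mathrm{Sim}(B_1,B_2)$ of surjective similarities $B_1\to B_2$ (maps $h$ with $d(h(x),h(y))=\lambda d(x,y)$ for some $\lambda>0$) such that the identities belong to it and it is closed under inverses, compositions, and restrictions to subballs (if $h\in\mathrm{Sim}(B_1,B_2)$ and $B_3\subseteq B_1$ is a ball, then $h|_{B_3}\in\mathrm{Sim}(B_3,h(B_3))$). It is *countable* if every $\mathrm{Sim}(B_1,B_2)$ is countable. Its group $\Gamma$ consists of all homeomorphisms $g$ of $X$ such that every $x\in X$ lies in a ball $B$ for which $g(B)$ is a ball and $g|_B\in \mathrm{Sim}(B,g(B))$. The group $\Gamma$ of a countable similarity structure is called a *CSS$^*$ group* if (1) every infinite proper ball of $X$ contains two disjoint infinite balls, and (2) for every proper ball $B$ and every infinite proper ball $D$ there is a ball $D_0\subseteq D$ with $\mathrm{Sim}(B,D_0)\neq\emptyset$. **Theorem.** Let $\Gamma$ be a CSS$^*$ group as above, and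 let $\Lambda\subseteq\Gamma$ be the set of elements $g$ whose support $\{x\in X: g(x)\ne x\}$ is finite. Let $S_\infty$ be the group of finitely supported permutations of $\mathbb N$. Then: 1. $\Lambda$ is a normal subgroup of $\Gamma$. 2. There is $n\in\{0,1,2,\dots\}\cup\{\infty\}$ such that $\Lambda$ is isomorphic to the restricted direct product of $n$ copies of $S_\infty$ (countably infinitely many copies if $n=\infty$; "restricted" means that all but finitely many components are trivial, so for finite $n$ it is the ordinary product). Moreover $n\ge 1$ if and only if $X$ has a finite ball. 3. If $X$ has a finite ball, then neither $\Gamma$ nor its commutator subgroup $[\Gamma,\Gamma]$ is $C^*$-simple, where a discrete group $G$ is called $C^*$-simple if its reduced $C^*$-algebra (the norm closure in $B(\ell^2(G))$ of the linear span of the left translations) has no norm-closed two-sided ideals other than $0$ and itself. -/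

import Mathlib

open scoped RestrictedProduct ENNReal

noncomputable section

/-! ### Similarity structures on ultrametric spaces -/

/-- The closed balls (of positive radius) of a metric space. -/
structure ClosedBalls (X : Type*) [MetricSpace X] where
  carrier : Set X
  isBall : ∃ x r, 0 < r ∧ carrier = Metric.closedBall x r

namespace ClosedBalls

variable {X : Type*} [MetricSpace X]

instance : SetLike (ClosedBalls X) X where
  coe B := B.carrier
  coe_injective := by
    rintro ⟨B, hB⟩ ⟨C, hC⟩ h
    cases h
    rfl

/-- A ball is infinite if it has infinitely many points. -/
def IsInfinite (B : ClosedBalls X) : Prop := (B : Set X).Infinite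

/-- A ball is finite if it has finitely many points. -/
def IsFinite (B : ClosedBalls X) : Prop := (B : Set X).Finite

/-- A ball is proper if it is properly contained in the whole space. -/
def IsProper (B : ClosedBalls X) : Prop := (B : Set X) ≠ Set.univ

/-- The closed ball with given centre and given positive radius. -/
def mk' (x : X) (r : ℝ) (hr : 0 < r) : ClosedBalls X :=
  ⟨Metric.closedBall x r, x, r, hr, rfl⟩

end ClosedBalls

/-- A similarity structure on `X`: a set `sim B₁ B₂` of surjective similarities `B₁ → B₂` for every
pair of closed balls, containing identities and closed under inverses, composition and
restriction. A surjective similarity is injective, so it is recorded as an equivalence. -/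
structure SimilarityStructure (X : Type*) [MetricSpace X] where
  sim (B₁ B₂ : ClosedBalls X) : Set (B₁ ≃ B₂)
  similarity : ∀ {B₁ B₂ : ClosedBalls X}, ∀ h ∈ sim B₁ B₂,
    ∃ c : ℝ, 0 < c ∧ ∀ x y : B₁, dist (h x) (h y) = c * dist x y
  identities : ∀ B : ClosedBalls X, Equiv.refl B ∈ sim B B
  inverses : ∀ {B₁ B₂ : ClosedBalls X}, ∀ h ∈ sim B₁ B₂, h.symm ∈ sim B₂ B₁
  composition : ∀ {B₁ B₂ B₃ : ClosedBalls X}, ∀ h₁ ∈ sim B₁ B₂, ∀ h₂ ∈ sim B₂ B₃,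
    h₁.trans h₂ ∈ sim B₁ B₃
  /-- If `k : B₃ ≃ B₄` is given by the formula of `h ∈ sim B₁ B₂` on a ball `B₃ ⊆ B₁`
  (so that `B₄ = h(B₃)` and `k` is the restriction of `h`), then `k ∈ sim B₃ B₄`. -/
  restrictions : ∀ {B₁ B₂ B₃ B₄ : ClosedBalls X}, ∀ h ∈ sim B₁ B₂,
    ∀ hsub : (B₃ : Set X) ⊆ (B₁ : Set X), ∀ k : B₃ ≃ B₄,
    (∀ x : B₃, (k x : X) = (h ⟨x, hsub x.2⟩ : X)) → k ∈ sim B₃ B₄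

namespace SimilarityStructure

variable {X : Type*} [MetricSpace X] (S : SimilarityStructure X)

/-- A countable similarity structure: every set `sim B₁ B₂` is countable (possibly finite). -/
def IsCountable : Prop := ∀ B₁ B₂ : ClosedBalls X, (S.sim B₁ B₂).Countable

/-- A map `g : X → X` is locally determined by `S` if every point lies in a ball `B` such that
`g(B)` is a ball `B'` and the restriction `B → B'` of `g` belongs to `sim B B'`. -/
def LocallyDetermined (g : X → X) : Prop :=
  ∀ x : X, ∃ B B' : ClosedBalls X, x ∈ B ∧ ∃ h ∈ S.sim B B', ∀ y : B, (h y : X) = g y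

/-- The image of a closed ball under a surjective similarity between closed balls
of an ultrametric space is a closed ball. -/
theorem exists_image_ball [IsUltrametricDist X] {B₁ B₂ C : ClosedBalls X} (h : B₁ ≃ B₂)
    (hh : ∃ c : ℝ, 0 < c ∧ ∀ x y : B₁, dist (h x) (h y) = c * dist x y)
    (hC : (C : Set X) ⊆ (B₁ : Set X)) :
    ∃ (D : ClosedBalls X) (k : C ≃ D), ∀ x : C, (k x : X) = (h ⟨x, hC x.2⟩ : X) := by
  obtain ⟨c, hc, hd⟩ := hh
  obtain ⟨C', p, r, hr, rfl⟩ := C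
  have hp : p ∈ B₁ := hC (Metric.mem_closedBall_self hr.le)
  obtain ⟨B', q, s, hs, rfl⟩ := B₂
  set hp' : X := (h ⟨p, hp⟩ : X) with hhp'
  have hq : Metric.closedBall q s = Metric.closedBall hp' s :=
    (IsUltrametricDist.closedBall_eq_of_mem (h ⟨p, hp⟩).2)
  refine ⟨ClosedBalls.mk' hp' (min (c * r) s) (lt_min (mul_pos hc hr) hs), ?_⟩
  refine ⟨Equiv.ofBijective (fun x => ⟨(h ⟨x, hC x.2⟩ : X), ?_⟩) ⟨?_, ?_⟩, fun x => rfl⟩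
  · refine Metric.mem_closedBall.2 (le_min ?_ ?_)
    · have h1 := hd ⟨x, hC x.2⟩ ⟨p, hp⟩
      have h2 : dist (x : X) p ≤ r := x.2
      calc dist ((h ⟨x, hC x.2⟩ : X)) hp' = c * dist (x : X) p := h1
        _ ≤ c * r := by gcongr
    · have h1 : ((h ⟨x, hC x.2⟩ : X)) ∈ Metric.closedBall q s := (h ⟨x, hC x.2⟩).2
      exact Metric.mem_closedBall.1 (hq.subset h1)
  · intro x y hxy
    have h1 : (h ⟨x, hC x.2⟩ : X) = (h ⟨y, hC y.2⟩ : X) := Subtype.mk.inj hxy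
    have h2 := h.injective (Subtype.ext h1)
    exact Subtype.ext (Subtype.mk.inj h2)
  · rintro ⟨y, hy⟩
    have hy' : dist y hp' ≤ min (c * r) s := hy
    have hyB : y ∈ Metric.closedBall q s := by
      rw [hq]; exact Metric.mem_closedBall.2 (hy'.trans (min_le_right _ _))
    obtain ⟨x, hx⟩ := h.surjective ⟨y, hyB⟩
    have h1 := hd x ⟨p, hp⟩
    rw [hx] at h1
    have h2 : dist y hp' = c * dist (x : X) p := h1
    have h3 : dist (x : X) p ≤ r := by
      have := hy'.trans (min_le_left _ _)
      rw [h2] at this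
      exact le_of_mul_le_mul_left this hc
    refine ⟨⟨x, h3⟩, Subtype.ext ?_⟩
    have h4 : (h x : X) = y := by rw [hx]
    exact h4

/-- Inside every ball around a point that is mapped by a homeomorphism into an ultrametric ball
there is a smaller ball that is mapped into it. -/
theorem exists_small_ball [IsUltrametricDist X] (g : X ≃ₜ X) (x : X) (B D : ClosedBalls X)
    (hx : x ∈ B) (hgx : g x ∈ D) :
    ∃ C : ClosedBalls X, x ∈ C ∧ (C : Set X) ⊆ (B : Set X) ∧ ∀ y ∈ C, g y ∈ D := by
  have open_ball : ∀ E : ClosedBalls X, IsOpen (E : Set X) := by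
    rintro ⟨E, p, r, hr, rfl⟩
    exact IsUltrametricDist.isOpen_closedBall p hr.ne'
  have hO : IsOpen ((B : Set X) ∩ g ⁻¹' (D : Set X)) :=
    (open_ball B).inter ((open_ball D).preimage g.continuous)
  obtain ⟨r, hr, hsub⟩ := Metric.nhds_basis_closedBall.mem_iff.1 (hO.mem_nhds ⟨hx, hgx⟩)
  exact ⟨ClosedBalls.mk' x r hr, Metric.mem_closedBall_self hr.le,
    fun y hy => (hsub hy).1, fun y hy => (hsub hy).2⟩

/-- The group associated to a similarity structure on an ultrametric space: all homeomorphisms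
of the space onto itself that are locally determined by the structure. -/
def group [IsUltrametricDist X] : Subgroup (X ≃ₜ X) where
  carrier := {g | S.LocallyDetermined g}
  one_mem' := fun x => ⟨ClosedBalls.mk' x 1 one_pos, _, Metric.mem_closedBall_self zero_le_one,
    Equiv.refl _, S.identities _, fun _ => rfl⟩
  mul_mem' := by
    intro g₁ g₂ hg₁ hg₂ x
    obtain ⟨B, B', hxB, h, hh, hy⟩ := hg₂ x
    obtain ⟨D, D', hxD, k, hk, hz⟩ := hg₁ (g₂ x)
    obtain ⟨C, hxC, hCB, hCD⟩ := exists_small_ball g₂ x B D hxB hxD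
    obtain ⟨E, u, hu⟩ := exists_image_ball h (S.similarity h hh) hCB
    have hED : (E : Set X) ⊆ (D : Set X) := by
      intro e he
      have h1 := hu (u.symm ⟨e, he⟩)
      rw [Equiv.apply_symm_apply, hy] at h1
      have h2 : e = g₂ (u.symm ⟨e, he⟩) := h1
      rw [h2]
      exact hCD _ (u.symm ⟨e, he⟩).2
    obtain ⟨F, v, hv⟩ := exists_image_ball k (S.similarity k hk) hED
    refine ⟨C, F, hxC, u.trans v, S.composition _ (S.restrictions h hh hCB u hu) _
      (S.restrictions k hk hED v hv), fun y => ?_⟩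
    have h1 : (u y : X) = g₂ y := (hu y).trans (hy _)
    have h2 : (v (u y) : X) = g₁ (u y) := (hv (u y)).trans (hz _)
    rw [h1] at h2
    exact h2
  inv_mem' := by
    intro g hg x
    obtain ⟨B, B', hxB, h, hh, hy⟩ := hg (g⁻¹ x)
    have hgx : g (g⁻¹ x) = x := g.apply_symm_apply x
    refine ⟨B', B, ?_, h.symm, S.inverses h hh, fun y => ?_⟩
    · have h1 := hy ⟨_, hxB⟩
      have h2 : (h ⟨_, hxB⟩ : X) = x := h1.trans hgx
      rw [← h2]
      exact (h ⟨_, hxB⟩).2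
    · have h1 := hy (h.symm y)
      rw [Equiv.apply_symm_apply] at h1
      rw [h1]
      exact (g.symm_apply_apply _).symm

/-- The two conditions which single out the CSS* groups among the groups of countable similarity
structures: every infinite proper ball contains two disjoint infinite balls, and for every proper
ball `B` and every infinite proper ball `D` some `sim B D₀` with `D₀ ⊆ D` is non-empty. -/
structure IsStar : Prop where
  two_infinite_subballs : ∀ B : ClosedBalls X, B.IsProper → B.IsInfinite →
    ∃ B₁ B₂ : ClosedBalls X, B₁.IsInfinite ∧ B₂.IsInfinite ∧
      (B₁ : Set X) ⊆ (B : Set X) ∧ (B₂ : Set X) ⊆ (B : Set X) ∧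
      Disjoint (B₁ : Set X) (B₂ : Set X)
  locally_homogeneous : ∀ B D : ClosedBalls X, B.IsProper → D.IsProper → D.IsInfinite →
    ∃ D₀ : ClosedBalls X, (D₀ : Set X) ⊆ (D : Set X) ∧ (S.sim B D₀).Nonempty

end SimilarityStructure

/-! ### Elements of finite support -/

/-- The subgroup `Λ` of the elements of finite support in a group `Γ` of homeomorphisms. -/
def finitelySupported {X : Type*} [TopologicalSpace X] (Γ : Subgroup (X ≃ₜ X)) : Subgroup Γ where
  carrier := {g | {x : X | (g : X ≃ₜ X) x ≠ x}.Finite}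
  one_mem' := by
    have : {x : X | ((1 : Γ) : X ≃ₜ X) x ≠ x} = ∅ := by ext x; simp
    simp only [Set.mem_ofPred_eq, this, Set.finite_empty]
  mul_mem' := by
    intro a b ha hb
    refine (Set.Finite.union ha hb).subset fun x hx => ?_
    by_contra hcon
    simp only [Set.mem_union, Set.mem_ofPred_eq, not_or, not_not] at hcon
    refine hx ?_
    change (a : X ≃ₜ X) ((b : X ≃ₜ X) x) = x
    rw [hcon.2, hcon.1]
  inv_mem' := by
    intro a ha
    refine Set.Finite.subset ha fun x hx hax => hx ?_
    change (a : X ≃ₜ X).symm x = x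
    exact (Homeomorph.symm_apply_eq _).2 hax.symm

/-- `S_∞`, the group of the permutations of `ℕ` that move only finitely many points. -/
def SInfinity : Subgroup (Equiv.Perm ℕ) where
  carrier := {σ | {k : ℕ | σ k ≠ k}.Finite}
  one_mem' := by simp
  mul_mem' := by
    intro a b ha hb
    refine (Set.Finite.union ha hb).subset fun x hx => ?_
    by_contra hcon
    simp only [Set.mem_union, Set.mem_ofPred_eq, not_or, not_not] at hcon
    exact hx (by rw [Equiv.Perm.mul_apply, hcon.2, hcon.1])
  inv_mem' := by
    intro a ha
    refine Set.Finite.subset ha fun x hx hax => hx ?_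
    exact Equiv.Perm.inv_eq_iff_eq.2 hax.symm

/-- The (restricted) direct product of `n` copies of a group `G`, where `n ∈ ℕ ∪ {∞}`: families
indexed by `{i : ℕ | i < n}`, all but finitely many members of which are trivial. For finite `n`
this is the usual `n`-fold product. -/
abbrev DirectPower (G : Type*) [Group G] (n : ℕ∞) : Type _ :=
  Πʳ _i : {i : ℕ // (i : ℕ∞) < n}, [G, ((⊥ : Subgroup G) : Set G)]

/-! ### C*-simplicity -/

/-- The Hilbert space `ℓ²(G)`. -/
abbrev EllTwo (G : Type*) : Type _ := lp (fun _ : G => ℂ) 2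

theorem memℓp_translate {G : Type*} [Group G] (g : G) (f : EllTwo G) :
    Memℓp (fun h : G => f (g⁻¹ * h)) 2 := by
  have h2 : (0 : ℝ) < (2 : ℝ≥0∞).toReal := by norm_num
  refine memℓp_gen ?_
  exact (Equiv.mulLeft g⁻¹).summable_iff.2 ((lp.memℓp f).summable h2)

/-- Left translation on `ℓ²(G)`, i.e. the operator `λ(g)` of the left regular representation:
`(λ(g) f)(h) = f(g⁻¹ h)`. -/
def leftRegular {G : Type*} [Group G] (g : G) : EllTwo G →L[ℂ] EllTwo G :=
  LinearIsometry.toContinuousLinearMap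
    { toFun := fun f => ⟨fun h => f (g⁻¹ * h), memℓp_translate g f⟩
      map_add' := fun _ _ => rfl
      map_smul' := fun _ _ => rfl
      norm_map' := by
        intro f
        have h2 : (0 : ℝ) < (2 : ℝ≥0∞).toReal := by norm_num
        rw [lp.norm_eq_tsum_rpow h2, lp.norm_eq_tsum_rpow h2]
        congr 1
        exact (Equiv.mulLeft g⁻¹).tsum_eq (fun h => ‖f h‖ ^ (2 : ℝ≥0∞).toReal) }

/-- The reduced C*-algebra of a discrete group: the norm closure in the bounded operators
on `ℓ²(G)` of the star-algebra generated by the left regular representation. -/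
def reducedCStarAlgebra (G : Type*) [Group G] : StarSubalgebra ℂ (EllTwo G →L[ℂ] EllTwo G) :=
  (StarAlgebra.adjoin ℂ (Set.range (leftRegular (G := G)))).topologicalClosure

/-- A discrete group is C*-simple if its reduced C*-algebra has no norm-closed two-sided ideals
except the zero ideal and the whole algebra. -/
def IsCStarSimple (G : Type*) [Group G] : Prop :=
  ∀ I : TwoSidedIdeal (reducedCStarAlgebra G),
    IsClosed (I : Set (reducedCStarAlgebra G)) → I = ⊥ ∨ I = ⊤

end

/-! Balls are open and X is Hausdorff, so the set of points moved by a homeomorphism is open. If it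
is finite, all its points are isolated, that is, singleton balls. An element of Γ restricts on such
a ball to a similarity in Sim, so it moves an isolated point only within its `Linked` class.
Conversely, every finitary permutation that preserves these classes is continuous and locally
determined. Hence Λ is exactly the group of finitary permutations along `Linked`
(`mem_range_finitelySupportedToPerm`). There are countably many isolated points since X is
separable, and each class is infinite by the two star conditions (`infinite_linked`). So Λ is a
restricted product of copies of S_∞, one for each class, and a class exists exactly when some ball
is finite.

For the C*-part, Λ is normal and locally finite. Let N be such a subgroup of a group G, and let u_F
be the unit vector in ℓ²(G) proportional to the indicator of a finite subgroup F of N. The operators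
a in the reduced C*-algebra with a u_F → 0 along the directed set of all F form a closed two-sided
ideal. It contains λ(n) - 1 for n in N, and does not contain 1
(`not_isCStarSimple_of_locallyFinite`). For the commutator subgroup, N is its intersection with Λ,
which is nontrivial because two transpositions sharing one point do not commute. -/

/-! ### Groups with a locally finite normal subgroup are not C*-simple -/

section CStarSimple

open Filter Topology

variable {G : Type*}

/-- The indicator function of a finite set as an element of `ℓ²(G)`. -/
noncomputable def indicatorVector (A : Set G) (hA : A.Finite) : EllTwo G :=
  ⟨A.indicator 1, by
    refine memℓp_gen (summable_of_hasFiniteSupport (hA.subset fun x hx => ?_))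
    by_contra hxA
    simp [hxA] at hx⟩

theorem indicatorVector_apply (A : Set G) (hA : A.Finite) (h : G) :
    indicatorVector A hA h = A.indicator 1 h := rfl

theorem indicator_one_congr {A B : Set G} {x y : G} (h : x ∈ A ↔ y ∈ B) :
    A.indicator (1 : G → ℂ) x = B.indicator 1 y := by
  by_cases hx : x ∈ A
  · rw [Set.indicator_of_mem hx, Set.indicator_of_mem (h.1 hx), Pi.one_apply, Pi.one_apply]
  · rw [Set.indicator_of_notMem hx, Set.indicator_of_notMem (hx ∘ h.2)]

variable [Group G]

theorem leftRegular_apply (g : G) (f : EllTwo G) (h : G) : leftRegular g f h = f (g⁻¹ * h) := rfl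

theorem norm_leftRegular_apply (g : G) (f : EllTwo G) : ‖leftRegular g f‖ = ‖f‖ := by
  have h2 : (0 : ℝ) < (2 : ℝ≥0∞).toReal := by norm_num
  rw [lp.norm_eq_tsum_rpow h2, lp.norm_eq_tsum_rpow h2]
  congr 1
  exact (Equiv.mulLeft g⁻¹).tsum_eq (fun h => ‖f h‖ ^ (2 : ℝ≥0∞).toReal)

theorem leftRegular_one : leftRegular (1 : G) = 1 := by
  ext f h
  simp [leftRegular_apply]

theorem leftRegular_mul (g h : G) : leftRegular (g * h) = leftRegular g * leftRegular h := by
  ext f k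
  simp [leftRegular_apply, mul_assoc]

theorem star_leftRegular (g : G) : star (leftRegular g) = leftRegular g⁻¹ := by
  rw [ContinuousLinearMap.star_eq_adjoint, eq_comm, ContinuousLinearMap.eq_adjoint_iff]
  intro x y
  change ∑' h, inner ℂ (leftRegular g⁻¹ x h) (y h) = ∑' h, inner ℂ (x h) (leftRegular g y h)
  rw [← (Equiv.mulLeft g).tsum_eq fun h => inner ℂ (x h : ℂ) (leftRegular g y h : ℂ)]
  exact tsum_congr fun h => by simp [leftRegular_apply]

/-- A closed subspace of operators that contains the left translations contains the reduced
C*-algebra. -/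
theorem mem_of_mem_reducedCStarAlgebra {M : Submodule ℂ (EllTwo G →L[ℂ] EllTwo G)}
    (hM : IsClosed (M : Set (EllTwo G →L[ℂ] EllTwo G))) (hg : ∀ g : G, leftRegular g ∈ M)
    {a : EllTwo G →L[ℂ] EllTwo G} (ha : a ∈ reducedCStarAlgebra G) : a ∈ M := by
  -- Since λ(g)* = λ(g⁻¹) and λ is multiplicative, the left translations are closed under adjoints
  -- and products. The star-algebra they generate is therefore their linear span.
  have hstar : Set.range (leftRegular (G := G)) ∪ star (Set.range (leftRegular (G := G))) =
      Set.range (leftRegular (G := G)) := by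
    refine Set.union_eq_left.2 ?_
    rintro _ ⟨g, hg⟩
    exact ⟨g⁻¹, by rw [← star_leftRegular, hg, star_star]⟩
  have hsub : ((StarAlgebra.adjoin ℂ (Set.range (leftRegular (G := G)))) :
      Set (EllTwo G →L[ℂ] EllTwo G)) ⊆ M := by
    intro b hb
    have hb' : b ∈ Algebra.adjoin ℂ (Set.range (leftRegular (G := G))) := by
      rw [← hstar, ← StarAlgebra.adjoin_toSubalgebra]
      exact hb
    let φ : G →* (EllTwo G →L[ℂ] EllTwo G) :=
      { toFun := leftRegular, map_one' := leftRegular_one, map_mul' := leftRegular_mul }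
    have hcl : ((Submonoid.closure (Set.range (leftRegular (G := G))) :
        Submonoid (EllTwo G →L[ℂ] EllTwo G)) : Set (EllTwo G →L[ℂ] EllTwo G)) ⊆ M := by
      have : Submonoid.closure (Set.range (leftRegular (G := G))) ≤ MonoidHom.mrange φ :=
        Submonoid.closure_le.2 (by rintro _ ⟨g, rfl⟩; exact ⟨g, rfl⟩)
      intro c hc
      obtain ⟨g, rfl⟩ := this hc
      exact hg g
    rw [← Subalgebra.mem_toSubmodule, Algebra.adjoin_eq_span] at hb'
    exact Submodule.span_le.2 hcl hb'
  exact closure_minimal hsub hM ha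

theorem leftRegular_mem_reducedCStarAlgebra (g : G) : leftRegular g ∈ reducedCStarAlgebra G :=
  StarSubalgebra.le_topologicalClosure _ (StarAlgebra.subset_adjoin ℂ _ ⟨g, rfl⟩)

/-! ### Right translations and the commutant of the reduced C*-algebra -/

theorem memℓp_translate_right (g : G) (f : EllTwo G) : Memℓp (fun h : G => f (h * g)) 2 := by
  have h2 : (0 : ℝ) < (2 : ℝ≥0∞).toReal := by norm_num
  exact memℓp_gen ((Equiv.mulRight g).summable_iff.2 ((lp.memℓp f).summable h2))

/-- Right translation on `ℓ²(G)`: `(ρ(g) f)(h) = f(h g)`. -/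
noncomputable def rightRegular (g : G) : EllTwo G →ₗᵢ[ℂ] EllTwo G where
  toFun f := ⟨fun h => f (h * g), memℓp_translate_right g f⟩
  map_add' _ _ := rfl
  map_smul' _ _ := rfl
  norm_map' f := by
    have h2 : (0 : ℝ) < (2 : ℝ≥0∞).toReal := by norm_num
    rw [lp.norm_eq_tsum_rpow h2, lp.norm_eq_tsum_rpow h2]
    congr 1
    exact (Equiv.mulRight g).tsum_eq (fun h => ‖f h‖ ^ (2 : ℝ≥0∞).toReal)

theorem rightRegular_apply (g : G) (f : EllTwo G) (h : G) : rightRegular g f h = f (h * g) := rfl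

/-- Left and right translations commute, and the identity is a closed linear condition on `a`. -/
theorem apply_rightRegular {a : EllTwo G →L[ℂ] EllTwo G} (ha : a ∈ reducedCStarAlgebra G) (g : G)
    (f : EllTwo G) : a (rightRegular g f) = rightRegular g (a f) := by
  let M : Submodule ℂ (EllTwo G →L[ℂ] EllTwo G) :=
    { carrier := {b | b (rightRegular g f) = rightRegular g (b f)}
      zero_mem' := by simp
      add_mem' := by
        intro b c hb hc
        simp_all
      smul_mem' := by
        intro z b hb
        simp_all }
  refine mem_of_mem_reducedCStarAlgebra (M := M) ?_ (fun k => ?_) ha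
  · exact isClosed_eq (by fun_prop) ((rightRegular g).continuous.comp (by fun_prop))
  · ext h
    simp [leftRegular_apply, rightRegular_apply, mul_assoc]

/-! ### Almost invariant unit vectors from finite subgroups -/

/-- The finite subgroups of a subgroup `N`. -/
abbrev FiniteSubgroupsIn (N : Subgroup G) : Type _ :=
  {F : Subgroup G // F ≤ N ∧ (F : Set G).Finite}

variable {N : Subgroup G}

instance : Nonempty (FiniteSubgroupsIn N) := ⟨⊥, bot_le, by simp⟩

/-- Local finiteness enters here: two finite subgroups generate a finite one. Directedness makes
`atTop` a proper filter, so limits along it are unique. -/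
theorem isDirected_finiteSubgroupsIn
    (hfin : ∀ s : Set G, s.Finite → s ⊆ N → (Subgroup.closure s : Set G).Finite) :
    IsDirectedOrder (FiniteSubgroupsIn N) where
  directed F₁ F₂ := by
    refine ⟨⟨Subgroup.closure (F₁.1 ∪ F₂.1 : Set G),
      (Subgroup.closure_le _).2 (Set.union_subset F₁.2.1 F₂.2.1),
      hfin _ (F₁.2.2.union F₂.2.2) (Set.union_subset F₁.2.1 F₂.2.1)⟩, ?_, ?_⟩
    · exact fun x hx => Subgroup.subset_closure (Or.inl hx)
    · exact fun x hx => Subgroup.subset_closure (Or.inr hx)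

/-- The normalised indicator function of a finite subgroup. -/
noncomputable def subgroupVector (F : FiniteSubgroupsIn N) : EllTwo G :=
  ((‖indicatorVector (F.1 : Set G) F.2.2‖⁻¹ : ℝ) : ℂ) • indicatorVector (F.1 : Set G) F.2.2

theorem norm_subgroupVector (F : FiniteSubgroupsIn N) : ‖subgroupVector F‖ = 1 := by
  have h0 : indicatorVector (F.1 : Set G) F.2.2 ≠ 0 := by
    intro h
    have h1 := indicatorVector_apply (F.1 : Set G) F.2.2 1
    rw [h] at h1
    simp [F.1.one_mem] at h1
  rw [subgroupVector, norm_smul, Complex.norm_real, norm_inv, norm_norm,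
    inv_mul_cancel₀ (norm_ne_zero_iff.2 h0)]

theorem leftRegular_subgroupVector_of_mem (F : FiniteSubgroupsIn N) {g : G} (hg : g ∈ F.1) :
    leftRegular g (subgroupVector F) = subgroupVector F := by
  rw [subgroupVector, map_smul]
  congr 1
  ext h
  rw [leftRegular_apply, indicatorVector_apply, indicatorVector_apply]
  have : g⁻¹ * h ∈ (F.1 : Set G) ↔ h ∈ (F.1 : Set G) :=
    F.1.mul_mem_cancel_left (F.1.inv_mem hg)
  exact indicator_one_congr this

/-- Conjugation of finite subgroups of a normal subgroup. -/
def conjFiniteSubgroup [hN : N.Normal] (g : G) (F : FiniteSubgroupsIn N) : FiniteSubgroupsIn N :=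
  ⟨F.1.map (MulAut.conj g).toMonoidHom, by
    rintro _ ⟨x, hx, rfl⟩
    exact hN.conj_mem x (F.2.1 hx) g, by
    rw [Subgroup.coe_map]
    exact F.2.2.image _⟩

/-- The coset gF equals (gFg⁻¹)g. A left translation is thus traded for a right one, which commutes
with the reduced C*-algebra. -/
theorem leftRegular_subgroupVector [N.Normal] (F : FiniteSubgroupsIn N) (g : G) :
    leftRegular g (subgroupVector F) =
      rightRegular g⁻¹ (subgroupVector (conjFiniteSubgroup g F)) := by
  have key : leftRegular g (indicatorVector (F.1 : Set G) F.2.2) =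
      rightRegular g⁻¹ (indicatorVector ((conjFiniteSubgroup g F).1 : Set G)
        (conjFiniteSubgroup g F).2.2) := by
    ext h
    rw [leftRegular_apply, rightRegular_apply, indicatorVector_apply, indicatorVector_apply]
    have : g⁻¹ * h ∈ (F.1 : Set G) ↔ h * g⁻¹ ∈ ((conjFiniteSubgroup g F).1 : Set G) := by
      constructor
      · intro hx
        exact ⟨_, hx, by simp⟩
      · rintro ⟨x, hx, hxh⟩
        have : g * x * g⁻¹ = h * g⁻¹ := by simpa using hxh
        have : g⁻¹ * h = x := by rw [← mul_right_cancel this]; group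
        rwa [this]
    exact indicator_one_congr this
  have hnorm : ‖indicatorVector (F.1 : Set G) F.2.2‖ =
      ‖indicatorVector ((conjFiniteSubgroup g F).1 : Set G) (conjFiniteSubgroup g F).2.2‖ := by
    rw [← norm_leftRegular_apply g, key, LinearIsometry.norm_map]
  rw [subgroupVector, subgroupVector, map_smul, map_smul, key, hnorm]

theorem tendsto_conjFiniteSubgroup [N.Normal] [IsDirectedOrder (FiniteSubgroupsIn N)] (g : G) :
    Tendsto (conjFiniteSubgroup (N := N) g) atTop atTop := by
  -- If F' contains g⁻¹Fg, then gF'g⁻¹ contains F.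
  refine tendsto_atTop_atTop.2 fun F => ⟨conjFiniteSubgroup g⁻¹ F, fun F' hF' x hx => ?_⟩
  exact ⟨g⁻¹ * x * g, hF' ⟨x, hx, by simp⟩, by simp [mul_assoc]⟩

/-! ### The closed ideal of operators vanishing along these vectors -/

/-- The operators `a` with `‖a u_F‖ → 0`, where `u_F` are the normalised indicator functions of
the finite subgroups `F` of `N`. -/
def vanishingSubmodule (N : Subgroup G) : Submodule ℂ (EllTwo G →L[ℂ] EllTwo G) where
  carrier := {a | Tendsto (fun F : FiniteSubgroupsIn N => a (subgroupVector F)) atTop (𝓝 0)}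
  zero_mem' := tendsto_const_nhds
  add_mem' := by
    intro a b ha hb
    simpa using Tendsto.add ha hb
  smul_mem' := by
    intro c a ha
    simpa using Tendsto.const_smul ha c

theorem mem_vanishingSubmodule {a : EllTwo G →L[ℂ] EllTwo G} : a ∈ vanishingSubmodule N ↔
    Tendsto (fun F : FiniteSubgroupsIn N => a (subgroupVector F)) atTop (𝓝 0) := Iff.rfl

/-- The vectors u_F have norm 1, so an operator within ε/2 of `a` differs from it by less than ε/2
on all of them at once. -/
theorem isClosed_vanishingSubmodule :
    IsClosed (vanishingSubmodule N : Set (EllTwo G →L[ℂ] EllTwo G)) := by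
  refine isClosed_of_closure_subset fun a ha => ?_
  rw [SetLike.mem_coe, mem_vanishingSubmodule, Metric.tendsto_nhds]
  intro ε hε
  obtain ⟨b, hb, hab⟩ := Metric.mem_closure_iff.1 ha (ε / 2) (by positivity)
  filter_upwards [Metric.tendsto_nhds.1 hb (ε / 2) (by positivity)] with F hF
  rw [dist_zero_right] at hF ⊢
  have h1 : ‖(a - b) (subgroupVector F)‖ ≤ ‖a - b‖ := by
    simpa [norm_subgroupVector] using (a - b).le_opNorm (subgroupVector F)
  rw [dist_eq_norm] at hab
  calc ‖a (subgroupVector F)‖ = ‖(a - b) (subgroupVector F) + b (subgroupVector F)‖ := by simp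
    _ ≤ ‖(a - b) (subgroupVector F)‖ + ‖b (subgroupVector F)‖ := norm_add_le _ _
    _ < ε := by linarith

theorem mul_mem_vanishingSubmodule_left (a : EllTwo G →L[ℂ] EllTwo G)
    {b : EllTwo G →L[ℂ] EllTwo G} (hb : b ∈ vanishingSubmodule N) :
    a * b ∈ vanishingSubmodule N := by
  have := (a.continuous.tendsto 0).comp hb
  rwa [map_zero] at this

/-- For b = λ(g) one has a λ(g) u_F = ρ(g⁻¹) a u_{gFg⁻¹}, which tends to 0 because conjugation tends
to infinity on the finite subgroups. The condition on `b` is closed and linear, so it passes to the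
whole algebra. -/
theorem mul_mem_vanishingSubmodule_right [N.Normal] [IsDirectedOrder (FiniteSubgroupsIn N)]
    {a b : EllTwo G →L[ℂ] EllTwo G} (haG : a ∈ reducedCStarAlgebra G)
    (ha : a ∈ vanishingSubmodule N) (hb : b ∈ reducedCStarAlgebra G) :
    a * b ∈ vanishingSubmodule N := by
  refine mem_of_mem_reducedCStarAlgebra
    (M := (vanishingSubmodule N).comap (LinearMap.mulLeft ℂ a)) ?_ (fun g => ?_) hb
  · exact isClosed_vanishingSubmodule.preimage (continuous_const.mul continuous_id)
  · change Tendsto (fun F : FiniteSubgroupsIn N => a (leftRegular g (subgroupVector F)))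
      atTop (𝓝 0)
    simp only [leftRegular_subgroupVector, apply_rightRegular haG]
    have := ((rightRegular g⁻¹).continuous.tendsto 0).comp
      (ha.comp (tendsto_conjFiniteSubgroup (N := N) g))
    rwa [map_zero] at this

/-- A group with a nontrivial locally finite normal subgroup is not C*-simple. -/
theorem not_isCStarSimple_of_locallyFinite [N.Normal]
    (hfin : ∀ s : Set G, s.Finite → s ⊆ N → (Subgroup.closure s : Set G).Finite) (hN : N ≠ ⊥) :
    ¬ IsCStarSimple G := by
  intro hsimple
  have := isDirected_finiteSubgroupsIn hfin
  let I : TwoSidedIdeal (reducedCStarAlgebra G) :=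
    TwoSidedIdeal.mk' {a | (a : EllTwo G →L[ℂ] EllTwo G) ∈ vanishingSubmodule N}
      (vanishingSubmodule N).zero_mem (fun ha hb => (vanishingSubmodule N).add_mem ha hb)
      (fun ha => (vanishingSubmodule N).neg_mem ha)
      (fun hb => mul_mem_vanishingSubmodule_left _ hb)
      (fun {a b} ha => mul_mem_vanishingSubmodule_right a.2 ha b.2)
  have hI : ∀ a : reducedCStarAlgebra G,
      a ∈ I ↔ (a : EllTwo G →L[ℂ] EllTwo G) ∈ vanishingSubmodule N :=
    fun a => TwoSidedIdeal.mem_mk' _ _ _ _ _ _ a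
  have hclosed : IsClosed (I : Set (reducedCStarAlgebra G)) := by
    have : (I : Set (reducedCStarAlgebra G)) =
        Subtype.val ⁻¹' (vanishingSubmodule N : Set (EllTwo G →L[ℂ] EllTwo G)) :=
      Set.ext hI
    rw [this]
    exact isClosed_vanishingSubmodule.preimage continuous_subtype_val
  rcases hsimple I hclosed with h | h
  · obtain ⟨n, hn1⟩ := N.ne_bot_iff_exists_ne_one.1 hN
    -- λ(n) - 1 annihilates u_F as soon as F contains n.
    have hmem : (⟨leftRegular (n : G), leftRegular_mem_reducedCStarAlgebra _⟩ - 1 :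
        reducedCStarAlgebra G) ∈ I := by
      rw [hI]
      refine tendsto_const_nhds.congr' ?_
      have hcl : ({(n : G)} : Set G) ⊆ N := Set.singleton_subset_iff.2 n.2
      filter_upwards [eventually_ge_atTop (⟨Subgroup.closure {(n : G)},
        (Subgroup.closure_le _).2 hcl, hfin _ (Set.finite_singleton _) hcl⟩ :
        FiniteSubgroupsIn N)] with F hF
      have hnF : (n : G) ∈ F.1 := hF (Subgroup.subset_closure rfl)
      change 0 = leftRegular (n : G) (subgroupVector F) - subgroupVector F
      rw [leftRegular_subgroupVector_of_mem F hnF, sub_self]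
    rw [h, TwoSidedIdeal.mem_bot, sub_eq_zero] at hmem
    have h1 : leftRegular (n : G) = 1 := congrArg Subtype.val hmem
    -- λ(n) moves the point mass at 1 to n, so it is not the identity.
    have h2 := indicatorVector_apply ({1} : Set G) (Set.finite_singleton _) 1
    have h3 : leftRegular (n : G) (indicatorVector ({1} : Set G) (Set.finite_singleton _)) 1 =
      indicatorVector ({1} : Set G) (Set.finite_singleton _) 1 := by rw [h1]; rfl
    rw [leftRegular_apply, indicatorVector_apply, indicatorVector_apply] at h3
    have hne : (n : G) ≠ 1 := fun h => hn1 (Subtype.ext h)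
    simp [hne] at h3
  -- If the ideal were everything, the unit vectors u_F would tend to 0.
  · have hone : (1 : reducedCStarAlgebra G) ∈ I := by rw [h]; trivial
    have h1 : Tendsto (fun F : FiniteSubgroupsIn N => subgroupVector F) atTop (𝓝 0) :=
      (hI 1).1 hone
    have h2 := h1.norm
    simp only [norm_subgroupVector, norm_zero] at h2
    exact one_ne_zero (tendsto_nhds_unique tendsto_const_nhds h2)

end CStarSimple

/-! ### Finitary permutations along the classes of a partial equivalence relation -/

section Finitary

open Equiv

variable {X : Type*}

/-- A permutation is finitary along a relation `r` if it moves only finitely many points and every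
moved point is related to its image. -/
def IsFinitaryAlong (r : X → X → Prop) (σ : Perm X) : Prop :=
  {x | σ x ≠ x}.Finite ∧ ∀ x, σ x ≠ x → r x (σ x)

theorem exists_equiv_index (Q : Type*) [Countable Q] :
    Nonempty (Q ≃ {i : ℕ // (i : ℕ∞) < ENat.card Q}) := by
  rcases finite_or_infinite Q with hQ | hQ
  · have : ∀ i : ℕ, (i : ℕ∞) < ENat.card Q ↔ i < Nat.card Q := fun i => by
      rw [ENat.card_eq_coe_natCard, Nat.cast_lt]
    exact ⟨(Finite.equivFin Q).trans (Fin.equivSubtype.trans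
      (Equiv.subtypeEquivRight fun i => (this i).symm))⟩
  · obtain ⟨hQ'⟩ := nonempty_denumerable Q
    refine ⟨(Denumerable.eqv Q).trans (Equiv.subtypeUnivEquiv fun i => ?_).symm⟩
    rw [ENat.card_eq_top_of_infinite]
    exact ENat.natCast_lt_top i

/-- Countably many countably infinite classes can be labelled by `{i | i < n} × ℕ`. -/
theorem exists_class_coordinates {r : X → X → Prop} (hsymm : ∀ x y, r x y → r y x)
    (htrans : ∀ x y z, r x y → r y z → r x z) (hcount : {x | r x x}.Countable)
    (hinf : ∀ x, r x x → {y | r x y}.Infinite) :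
    ∃ n : ℕ∞, ((∃ x, r x x) ↔ 1 ≤ n) ∧ ∃ e : {i : ℕ // (i : ℕ∞) < n} × ℕ ≃ {x // r x x},
      ∀ a b, r (e a) (e b) ↔ a.1 = b.1 := by
  -- On the points related to themselves the partial equivalence relation is reflexive.
  let s : Setoid {x // r x x} :=
    ⟨fun x y => r x y, fun x => x.2, fun h => hsymm _ _ h, fun h h' => htrans _ _ _ h h'⟩
  have : Countable {x // r x x} := hcount
  have hfib : ∀ q : Quotient s, Nonempty ({x // Quotient.mk s x = q} ≃ ℕ) := by
    intro q
    obtain ⟨x, rfl⟩ := Quotient.exists_rep q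
    have h1 : Infinite {y // r (x : X) y} := (hinf x x.2).to_subtype
    have h2 : Infinite {y // Quotient.mk s y = Quotient.mk s x} := by
      refine Infinite.of_injective (fun y : {y // r (x : X) y} =>
        ⟨⟨y, htrans _ _ _ (hsymm _ _ y.2) y.2⟩, Quotient.sound (hsymm _ _ y.2)⟩) fun y z h => ?_
      exact Subtype.ext (congrArg (fun w => (w.1 : X)) h)
    obtain ⟨h3⟩ := nonempty_denumerable {y // Quotient.mk s y = Quotient.mk s x}
    exact ⟨Denumerable.eqv _⟩
  let φ := fun q => Classical.choice (hfib q)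
  obtain ⟨ψ⟩ := exists_equiv_index (Quotient s)
  let E : {x // r x x} ≃ {i : ℕ // (i : ℕ∞) < ENat.card (Quotient s)} × ℕ :=
    (Equiv.sigmaFiberEquiv (Quotient.mk s)).symm.trans
      ((Equiv.sigmaCongrRight φ).trans ((Equiv.sigmaEquivProd _ _).trans
        (Equiv.prodCongr ψ (Equiv.refl ℕ))))
  have hE : ∀ x, (E x).1 = ψ (Quotient.mk s x) := fun x => rfl
  refine ⟨ENat.card (Quotient s), ?_, E.symm, fun a b => ?_⟩
  · rw [ENat.one_le_card_iff_nonempty, nonempty_quotient_iff, nonempty_subtype]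
  · have h1 : a.1 = ψ (Quotient.mk s (E.symm a)) := by rw [← hE, Equiv.apply_symm_apply]
    have h2 : b.1 = ψ (Quotient.mk s (E.symm b)) := by rw [← hE, Equiv.apply_symm_apply]
    rw [h1, h2, ψ.apply_eq_iff_eq, Quotient.eq]
    rfl

variable {n : ℕ∞}

/-- The action of the restricted product on the disjoint union of `n` copies of `ℕ`. -/
def directPowerToPerm (n : ℕ∞) :
    DirectPower SInfinity n →* Perm ({i : ℕ // (i : ℕ∞) < n} × ℕ) where
  toFun f := Equiv.prodCongrRight fun i => (f i : Perm ℕ)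
  map_one' := rfl
  map_mul' _ _ := rfl

theorem directPowerToPerm_apply (f : DirectPower SInfinity n)
    (a : {i : ℕ // (i : ℕ∞) < n} × ℕ) :
    directPowerToPerm n f a = (a.1, (f a.1 : Perm ℕ) a.2) := rfl

theorem directPowerToPerm_injective : Function.Injective (directPowerToPerm n) := by
  intro f g h
  refine RestrictedProduct.ext _ _ fun i => Subtype.ext (Equiv.ext fun k => ?_)
  simpa [directPowerToPerm_apply] using congrArg (fun σ => σ (i, k)) h

theorem directPowerToPerm_isFinitaryAlong (f : DirectPower SInfinity n) :
    IsFinitaryAlong (fun a b => a.1 = b.1) (directPowerToPerm n f) := by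
  refine ⟨?_, fun a _ => rfl⟩
  have h1 : {i | f i ≠ 1}.Finite := f.2
  refine (h1.biUnion fun i _ => ((f i).2 : {k | (f i : Perm ℕ) k ≠ k}.Finite).image
    (Prod.mk i)).subset fun a ha => ?_
  have ha' : (f a.1 : Perm ℕ) a.2 ≠ a.2 := fun h => ha (Prod.ext rfl h)
  refine Set.mem_biUnion (x := a.1) (fun h => ?_) ⟨a.2, ha', rfl⟩
  rw [h] at ha'
  exact ha' rfl

/-- Such a permutation preserves each copy of ℕ and splits into components. Finiteness of its
support makes every component finitary and all but finitely many trivial. -/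
theorem exists_directPowerToPerm_eq {σ : Perm ({i : ℕ // (i : ℕ∞) < n} × ℕ)}
    (hσ : IsFinitaryAlong (fun a b => a.1 = b.1) σ) : ∃ f, directPowerToPerm n f = σ := by
  have h1 : ∀ a, (σ a).1 = a.1 := fun a => by
    by_cases h : σ a = a
    · rw [h]
    · exact (hσ.2 a h).symm
  have h2 : ∀ a, (σ.symm a).1 = a.1 := fun a => by
    rw [← h1 (σ.symm a), Equiv.apply_symm_apply]
  let f : {i : ℕ // (i : ℕ∞) < n} → Perm ℕ := fun i =>
    { toFun := fun k => (σ (i, k)).2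
      invFun := fun k => (σ.symm (i, k)).2
      left_inv := fun k => by
        have : (i, (σ (i, k)).2) = σ (i, k) := Prod.ext (h1 (i, k)).symm rfl
        simp [this]
      right_inv := fun k => by
        have : (i, (σ.symm (i, k)).2) = σ.symm (i, k) := Prod.ext (h2 (i, k)).symm rfl
        simp [this] }
  have hf : ∀ i k, f i k ≠ k → σ (i, k) ≠ (i, k) := fun i k h h' => h (congrArg Prod.snd h')
  have hfS : ∀ i, f i ∈ SInfinity := fun i =>
    Set.Finite.subset (hσ.1.image Prod.snd) fun k hk => ⟨(i, k), hf i k hk, rfl⟩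
  refine ⟨⟨fun i => ⟨f i, hfS i⟩, ?_⟩, Equiv.ext fun a => Prod.ext (h1 a).symm rfl⟩
  refine Filter.mem_cofinite.2 ((hσ.1.image Prod.fst).subset fun i hi => ?_)
  obtain ⟨k, hk⟩ : ∃ k, f i k ≠ k := by
    by_contra! h
    exact hi (Subtype.ext (Equiv.ext h))
  exact ⟨(i, k), hf i k hk, rfl⟩

/-- The finitary permutations along a partial equivalence relation with countably many classes,
all of them countably infinite, form a restricted product of copies of `S_∞`. -/
theorem exists_directPower_hom {r : X → X → Prop} (hsymm : ∀ x y, r x y → r y x)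
    (htrans : ∀ x y z, r x y → r y z → r x z) (hcount : {x | r x x}.Countable)
    (hinf : ∀ x, r x x → {y | r x y}.Infinite) :
    ∃ n : ℕ∞, ((∃ x, r x x) ↔ 1 ≤ n) ∧ ∃ Φ : DirectPower SInfinity n →* Perm X,
      Function.Injective Φ ∧ ∀ σ, σ ∈ Φ.range ↔ IsFinitaryAlong r σ := by
  classical
  obtain ⟨n, hn, e, he⟩ := exists_class_coordinates hsymm htrans hcount hinf
  refine ⟨n, hn, (Perm.extendDomainHom e).comp (directPowerToPerm n),
    (Perm.extendDomainHom_injective e).comp directPowerToPerm_injective, fun σ => ⟨?_, fun h => ?_⟩⟩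
  · rintro ⟨f, rfl⟩
    have hmoved : ∀ x, Perm.extendDomainHom e (directPowerToPerm n f) x ≠ x →
        ∃ a, (e a : X) = x ∧ directPowerToPerm n f a ≠ a := by
      intro x hx
      have hr : r x x := by
        by_contra hr
        exact hx (Perm.extendDomain_apply_not_subtype _ _ hr)
      refine ⟨e.symm ⟨x, hr⟩, by simp, fun h => hx ?_⟩
      rw [Perm.extendDomainHom_apply, Perm.extendDomain_apply_subtype _ e hr, h]
      simp
    obtain ⟨h1, h2⟩ := directPowerToPerm_isFinitaryAlong f
    refine ⟨(h1.image fun a => (e a : X)).subset fun x hx => ?_, fun x hx => ?_⟩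
    · obtain ⟨a, rfl, ha⟩ := hmoved x hx
      exact ⟨a, ha, rfl⟩
    · obtain ⟨a, rfl, ha⟩ := hmoved x hx
      change r _ (Perm.extendDomain _ _ _)
      rw [Perm.extendDomain_apply_image, he]
      exact h2 a ha
  -- A moved point is related to its image, hence to itself. So σ restricts to the points related to
  -- themselves.
  · have hr : ∀ x, σ x ≠ x → r x x := fun x hx =>
      htrans _ _ _ (h.2 x hx) (hsymm _ _ (h.2 x hx))
    have hp : ∀ x, r (σ x) (σ x) ↔ r x x := fun x => by
      by_cases hx : σ x = x
      · rw [hx]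
      · exact ⟨fun _ => hr x hx, fun _ => htrans _ _ _ (hsymm _ _ (h.2 x hx)) (h.2 x hx)⟩
    let τ : Perm ({i : ℕ // (i : ℕ∞) < n} × ℕ) := e.symm.permCongr (σ.subtypePerm hp)
    have hτ : ∀ a, (e (τ a) : X) = σ (e a) := fun a => by simp [τ, Equiv.permCongr_apply]
    have hτr : IsFinitaryAlong (fun a b => a.1 = b.1) τ := by
      constructor
      · refine Set.Finite.of_finite_image (f := fun a => (e a : X)) (h.1.subset ?_)
          (Subtype.val_injective.comp e.injective).injOn
        rintro _ ⟨a, ha, rfl⟩ hσ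
        exact ha (e.injective (Subtype.ext ((hτ a).trans hσ)))
      · intro a ha
        refine (he a (τ a)).1 ?_
        rw [hτ]
        exact h.2 _ fun hσ => ha (e.injective (Subtype.ext ((hτ a).trans hσ)))
    obtain ⟨f, hf⟩ := exists_directPowerToPerm_eq hτr
    refine ⟨f, Equiv.ext fun x => ?_⟩
    rw [MonoidHom.comp_apply, hf]
    by_cases hx : r x x
    · obtain ⟨a, ha⟩ := e.surjective ⟨x, hx⟩
      obtain rfl : (e a : X) = x := by rw [ha]
      rw [Perm.extendDomainHom_apply, Perm.extendDomain_apply_image, hτ]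
    · rw [Perm.extendDomainHom_apply, Perm.extendDomain_apply_not_subtype _ e hx]
      by_contra hne
      exact hx (hr x (Ne.symm hne))

end Finitary

/-! ### Finitely supported elements of the group of a similarity structure -/

theorem mem_finitelySupported {X : Type*} [TopologicalSpace X] {Γ : Subgroup (X ≃ₜ X)} {g : Γ} :
    g ∈ finitelySupported Γ ↔ {x : X | (g : X ≃ₜ X) x ≠ x}.Finite := Iff.rfl

theorem finitelySupported_normal {X : Type*} [TopologicalSpace X] (Γ : Subgroup (X ≃ₜ X)) :
    (finitelySupported Γ).Normal where
  conj_mem g hg h := by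
    refine ((mem_finitelySupported.1 hg).image (h : X ≃ₜ X)).subset fun x hx => ?_
    refine ⟨(h : X ≃ₜ X).symm x, fun hgx => hx ?_, (h : X ≃ₜ X).apply_symm_apply x⟩
    change (h : X ≃ₜ X) ((g : X ≃ₜ X) ((h : X ≃ₜ X).symm x)) = x
    rw [hgx, Homeomorph.apply_symm_apply]

/-- Finitely many elements of finite support generate a finite group. -/
theorem finite_closure_of_subset_finitelySupported {X : Type*} [TopologicalSpace X]
    (Γ : Subgroup (X ≃ₜ X)) (s : Set Γ) (hs : s.Finite) (hsΓ : s ⊆ finitelySupported Γ) :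
    (Subgroup.closure s : Set Γ).Finite := by
  -- All elements of the generated group fix the complement of the finite set T and map T into
  -- itself. They are determined by their restrictions to T, and T has only finitely many self-maps.
  set T : Set X := ⋃ g ∈ s, {x | (g : X ≃ₜ X) x ≠ x} with hT
  have hTfin : T.Finite := hs.biUnion fun g hg => mem_finitelySupported.1 (hsΓ hg)
  have hfix : ∀ g ∈ Subgroup.closure s, ∀ x ∉ T, (g : X ≃ₜ X) x = x := by
    intro g hg
    induction hg using Subgroup.closure_induction with
    | mem g hg =>
      intro x hx
      by_contra h
      exact hx (Set.mem_biUnion hg h)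
    | one => exact fun x _ => rfl
    | mul a b _ _ ha hb =>
      intro x hx
      change (a : X ≃ₜ X) ((b : X ≃ₜ X) x) = x
      rw [hb x hx, ha x hx]
    | inv a _ ha =>
      intro x hx
      exact (Homeomorph.symm_apply_eq _).2 (ha x hx).symm
  have hmaps : ∀ g ∈ Subgroup.closure s, ∀ x ∈ T, (g : X ≃ₜ X) x ∈ T := by
    intro g hg x hx
    by_contra h
    have h1 : (g : X ≃ₜ X) x = x := (g : X ≃ₜ X).injective (hfix g hg _ h)
    rw [h1] at h
    exact h hx
  have := hTfin.to_subtype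
  let restr : Subgroup.closure s → T → T := fun g x => ⟨((g : Γ) : X ≃ₜ X) x, hmaps g g.2 x x.2⟩
  have hinj : Function.Injective restr := by
    intro g h hgh
    refine Subtype.ext (Subtype.ext (Homeomorph.ext fun x => ?_))
    by_cases hx : x ∈ T
    · exact congrArg Subtype.val (congrFun hgh ⟨x, hx⟩)
    · rw [hfix g g.2 x hx, hfix h h.2 x hx]
  exact Finite.of_injective restr hinj

namespace SimilarityStructure

open Topology Equiv

variable {X : Type*} [MetricSpace X] (S : SimilarityStructure X)

/-- Two isolated points are linked if the structure contains a similarity between them. -/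
def Linked (x y : X) : Prop :=
  ∃ B B' : ClosedBalls X, (B : Set X) = {x} ∧ (B' : Set X) = {y} ∧ (S.sim B B').Nonempty

variable {S}

theorem Linked.symm {x y : X} (h : S.Linked x y) : S.Linked y x := by
  obtain ⟨B, B', hB, hB', k, hk⟩ := h
  exact ⟨B', B, hB', hB, k.symm, S.inverses k hk⟩

theorem Linked.trans {x y z : X} (h : S.Linked x y) (h' : S.Linked y z) : S.Linked x z := by
  obtain ⟨B, B', hB, hB', k, hk⟩ := h
  obtain ⟨C, C', hC, hC', l, hl⟩ := h'
  -- A ball is recorded as a set, without centre and radius, so the two balls agree.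
  obtain rfl : B' = C := SetLike.coe_injective (hB'.trans hC.symm)
  exact ⟨B, C', hB, hC', k.trans l, S.composition k hk l hl⟩

theorem _root_.ClosedBalls.nonempty (B : ClosedBalls X) : (B : Set X).Nonempty := by
  obtain ⟨B, x, r, hr, rfl⟩ := B
  exact ⟨x, Metric.mem_closedBall_self hr.le⟩

theorem _root_.ClosedBalls.isOpen [IsUltrametricDist X] (B : ClosedBalls X) :
    IsOpen (B : Set X) := by
  obtain ⟨B, x, r, hr, rfl⟩ := B
  exact IsUltrametricDist.isOpen_closedBall x hr.ne'

theorem exists_coe_eq_singleton {x : X} (hx : IsOpen ({x} : Set X)) :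
    ∃ B : ClosedBalls X, (B : Set X) = {x} := by
  obtain ⟨r, hr, h⟩ := Metric.nhds_basis_closedBall.mem_iff.1 (hx.mem_nhds rfl)
  exact ⟨ClosedBalls.mk' x r hr,
    h.antisymm (Set.singleton_subset_iff.2 (Metric.mem_closedBall_self hr.le))⟩

/-- Together with `Linked.isOpen` this identifies the points linked to themselves with the isolated
points. -/
theorem linked_self_of_isOpen {x : X} (hx : IsOpen ({x} : Set X)) : S.Linked x x := by
  obtain ⟨B, hB⟩ := exists_coe_eq_singleton hx
  exact ⟨B, B, hB, hB, _, S.identities B⟩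

variable [IsUltrametricDist X]

theorem Linked.isOpen {x y : X} (h : S.Linked x y) : IsOpen ({x} : Set X) := by
  obtain ⟨B, -, hB, -⟩ := h
  rw [← hB]
  exact B.isOpen

theorem exists_linked_iff_exists_isFinite :
    (∃ x, S.Linked x x) ↔ ∃ B : ClosedBalls X, B.IsFinite := by
  refine ⟨?_, ?_⟩
  · rintro ⟨x, B, -, hB, -⟩
    refine ⟨B, ?_⟩
    rw [ClosedBalls.IsFinite, hB]
    exact Set.finite_singleton x
  · rintro ⟨B, hB⟩
    obtain ⟨x, hx⟩ := B.nonempty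
    refine ⟨x, linked_self_of_isOpen ?_⟩
    -- Removing from a finite open set all points but x, a closed set, leaves {x} open.
    have h1 : IsOpen ((B : Set X) \ ((B : Set X) \ {x})) :=
      B.isOpen.sdiff (Set.Finite.subset hB Set.sdiff_subset).isClosed
    rwa [Set.sdiff_sdiff_cancel_left (Set.singleton_subset_iff.2 hx)] at h1

/-- The similarity representing g near x restricts to the ball {x}, and the image of that ball is
the ball {g x}. -/
theorem linked_apply {g : X ≃ₜ X} (hg : g ∈ S.group) {x : X} (hx : IsOpen ({x} : Set X)) :
    S.Linked x (g x) := by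
  obtain ⟨B, B', hxB, h, hh, hy⟩ := hg x
  obtain ⟨C, hC⟩ := exists_coe_eq_singleton hx
  have hCB : (C : Set X) ⊆ B := by
    rw [hC]
    exact Set.singleton_subset_iff.2 hxB
  obtain ⟨D, k, hk⟩ := exists_image_ball h (S.similarity h hh) hCB
  have hval : ∀ c : C, (k c : X) = g x := fun c => by
    have hc : (c : X) = x := by
      have := c.2
      rwa [← SetLike.mem_coe, hC] at this
    rw [hk, hy, hc]
  refine ⟨C, D, hC, Set.ext fun y => ⟨fun hyD => ?_, fun hy => ?_⟩, k,
    S.restrictions h hh hCB k hk⟩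
  · have := hval (k.symm ⟨y, hyD⟩)
    rwa [Equiv.apply_symm_apply] at this
  · obtain rfl : y = g x := hy
    have hxC : x ∈ C := by
      rw [← SetLike.mem_coe, hC]
      rfl
    rw [← hval ⟨x, hxC⟩]
    exact (k _).2

/-- The support is open in a Hausdorff space; being finite, it consists of isolated points. -/
theorem isFinitaryAlong_linked {g : S.group} (hg : g ∈ finitelySupported S.group) :
    IsFinitaryAlong S.Linked (g : X ≃ₜ X).toEquiv := by
  refine ⟨hg, fun x hx => linked_apply g.2 ?_⟩
  have h1 : IsOpen {y : X | (g : X ≃ₜ X) y ≠ y} :=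
    isOpen_ne_fun (g : X ≃ₜ X).continuous continuous_id
  have h2 : IsOpen ({y : X | (g : X ≃ₜ X) y ≠ y} \ ({y : X | (g : X ≃ₜ X) y ≠ y} \ {x})) :=
    h1.sdiff (Set.Finite.subset hg Set.sdiff_subset).isClosed
  rwa [Set.sdiff_sdiff_cancel_left (Set.singleton_subset_iff.2 hx)] at h2

end SimilarityStructure

/-! ### Finitary permutations along linked points as elements of the group -/

theorem IsFinitaryAlong.symm {X : Type*} {r : X → X → Prop} (hsymm : ∀ x y, r x y → r y x)
    {σ : Equiv.Perm X} (h : IsFinitaryAlong r σ) : IsFinitaryAlong r σ.symm := by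
  have key : ∀ x, σ.symm x ≠ x → σ (σ.symm x) ≠ σ.symm x := fun x hx => by
    rw [Equiv.apply_symm_apply]
    exact hx.symm
  have key' : ∀ x, σ.symm x ≠ x → σ x ≠ x := fun x hx h' =>
    hx ((Equiv.symm_apply_eq σ).2 h'.symm)
  refine ⟨h.1.subset key', fun x hx => hsymm _ _ ?_⟩
  simpa using h.2 _ (key x hx)

theorem isFinitaryAlong_swap {X : Type*} [DecidableEq X] {r : X → X → Prop}
    (hsymm : ∀ x y, r x y → r y x) {x y : X} (h : r x y) : IsFinitaryAlong r (Equiv.swap x y) := by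
  refine ⟨(Set.toFinite {x, y}).subset fun z hz => ?_, fun z hz => ?_⟩
  · by_contra hne
    simp only [Set.mem_insert_iff, Set.mem_singleton_iff, not_or] at hne
    exact hz (Equiv.swap_apply_of_ne_of_ne hne.1 hne.2)
  · by_cases hzx : z = x
    · rw [hzx, Equiv.swap_apply_left]
      exact h
    · by_cases hzy : z = y
      · rw [hzy, Equiv.swap_apply_right]
        exact hsymm _ _ h
      · exact absurd (Equiv.swap_apply_of_ne_of_ne hzx hzy) hz

/-- Near a fixed point σ is the identity, since its support is finite and hence closed. Moved points
are isolated. -/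
theorem IsFinitaryAlong.continuous {X : Type*} [TopologicalSpace X] [T1Space X]
    {r : X → X → Prop} (hopen : ∀ x y, r x y → IsOpen ({x} : Set X))
    {σ : Equiv.Perm X} (h : IsFinitaryAlong r σ) : Continuous σ := by
  refine continuous_iff_continuousAt.2 fun x => ?_
  by_cases hx : σ x = x
  · have : ∀ᶠ y in nhds x, σ y = y := by
      filter_upwards [h.1.isClosed.isOpen_compl.mem_nhds (show x ∈ _ from fun h => h hx)] with y hy
      by_contra hne
      exact hy hne
    exact continuousAt_id.congr (this.mono fun y hy => hy.symm)
  · rw [ContinuousAt, (isOpen_singleton_iff_nhds_eq_pure x).1 (hopen _ _ (h.2 x hx))]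
    exact (Filter.tendsto_pure_pure _ _).mono_right (pure_le_nhds _)

namespace SimilarityStructure

open Topology Equiv

variable {X : Type*} [MetricSpace X] [IsUltrametricDist X] {S : SimilarityStructure X}

/-- A fixed point has a ball that misses the support, where the identity serves. At a moved point
the linking similarity goes between singletons and so must agree with σ. -/
theorem exists_mem_finitelySupported {σ : Perm X} (hσ : IsFinitaryAlong S.Linked σ) :
    ∃ g ∈ finitelySupported S.group, ((g : S.group) : X ≃ₜ X).toEquiv = σ := by
  let g : X ≃ₜ X :=
    { σ with
      continuous_toFun := hσ.continuous fun _ _ h => h.isOpen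
      continuous_invFun := (hσ.symm fun _ _ h => h.symm).continuous fun _ _ h => h.isOpen }
  have hg : g ∈ S.group := by
    intro x
    by_cases hx : σ x = x
    · obtain ⟨r, hr, h⟩ := Metric.nhds_basis_closedBall.mem_iff.1
        (hσ.1.isClosed.isOpen_compl.mem_nhds (show x ∈ _ from fun h => h hx))
      refine ⟨ClosedBalls.mk' x r hr, ClosedBalls.mk' x r hr, Metric.mem_closedBall_self hr.le,
        _, S.identities _, fun y => ?_⟩
      by_contra hne
      exact h y.2 (Ne.symm hne)
    · obtain ⟨B, B', hB, hB', k, hk⟩ := hσ.2 x hx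
      refine ⟨B, B', ?_, k, hk, fun y => ?_⟩
      · rw [← SetLike.mem_coe, hB]
        rfl
      · have h1 : (k y : X) = σ x := by
          have := (k y).2
          rwa [← SetLike.mem_coe, hB'] at this
        have h2 : (y : X) = x := by
          have := y.2
          rwa [← SetLike.mem_coe, hB] at this
        rw [h1, h2]
        rfl
  exact ⟨⟨g, hg⟩, hσ.1, rfl⟩

/-- The action of the finitely supported elements on the points. -/
def finitelySupportedToPerm (S : SimilarityStructure X) :
    finitelySupported S.group →* Perm X where
  toFun g := ((g : S.group) : X ≃ₜ X).toEquiv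
  map_one' := rfl
  map_mul' _ _ := rfl

theorem finitelySupportedToPerm_injective : Function.Injective (finitelySupportedToPerm S) :=
  fun _ _ h => Subtype.ext (Subtype.ext (Homeomorph.toEquiv_injective h))

theorem mem_range_finitelySupportedToPerm {σ : Perm X} :
    σ ∈ (finitelySupportedToPerm S).range ↔ IsFinitaryAlong S.Linked σ := by
  refine ⟨?_, fun h => ?_⟩
  · rintro ⟨g, rfl⟩
    exact isFinitaryAlong_linked g.2
  · obtain ⟨g, hg, rfl⟩ := exists_mem_finitelySupported h
    exact ⟨⟨g, hg⟩, rfl⟩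

/-! ### Countability and infinitude of the linked classes -/

theorem countable_linked [CompactSpace X] : {x | S.Linked x x}.Countable := by
  obtain ⟨D, hD, hdense⟩ := TopologicalSpace.exists_countable_dense X
  -- An isolated point belongs to every dense set.
  refine hD.mono fun x hx => ?_
  obtain ⟨y, hy, hyD⟩ := hdense.inter_open_nonempty _ (Linked.isOpen hx) ⟨x, rfl⟩
  obtain rfl : y = x := hy
  exact hyD

/-- An infinite compact ultrametric space contains an infinite proper ball. -/
theorem exists_infinite_proper_ball (X : Type*) [MetricSpace X] [IsUltrametricDist X]
    [CompactSpace X] [Infinite X] : ∃ D : ClosedBalls X, D.IsProper ∧ D.IsInfinite := by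
  obtain ⟨x, y, hxy⟩ := exists_pair_ne X
  -- By the ultrametric inequality no ball of radius half the distance contains both x and y, so all
  -- balls of this radius are proper. Finitely many cover X, hence one of them is infinite.
  have hr : 0 < dist x y / 2 := half_pos (dist_pos.2 hxy)
  obtain ⟨t, -, ht, hcover⟩ := (isCompact_univ (X := X)).finite_cover_balls hr
  by_contra! hall
  have hfin : ∀ z : X, (Metric.closedBall z (dist x y / 2)).Finite := fun z => by
    refine Set.not_infinite.1 (hall (ClosedBalls.mk' z _ hr) fun huniv => ?_)
    have hx : x ∈ Metric.closedBall z (dist x y / 2) := huniv.ge (Set.mem_univ x)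
    have hy : y ∈ Metric.closedBall z (dist x y / 2) := huniv.ge (Set.mem_univ y)
    have h1 := IsUltrametricDist.dist_triangle_max x z y
    rw [dist_comm z y] at h1
    have h2 := h1.trans (max_le hx hy)
    linarith
  refine Set.infinite_univ ((ht.biUnion fun z _ => hfin z).subset (hcover.trans ?_))
  exact Set.iUnion₂_mono fun z _ => Metric.ball_subset_closedBall

/-- Local homogeneity, applied to the singleton ball {x}, puts a point of the class of x into every
infinite proper ball. Repeated splitting into disjoint infinite balls then yields arbitrarily many
such points. -/
theorem infinite_linked [CompactSpace X] [Infinite X] (hstar : S.IsStar) {x : X}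
    (hx : S.Linked x x) : {y | S.Linked x y}.Infinite := by
  obtain ⟨B, -, hB, -⟩ := hx
  have hBp : B.IsProper := fun h =>
    Set.infinite_univ (h ▸ hB ▸ Set.finite_singleton x : (Set.univ : Set X).Finite)
  have hmeet : ∀ D : ClosedBalls X, D.IsProper → D.IsInfinite →
      ((D : Set X) ∩ {y | S.Linked x y}).Nonempty := by
    intro D hD hD'
    obtain ⟨D₀, hD₀, k, hk⟩ := hstar.locally_homogeneous B D hBp hD hD'
    have hxB : x ∈ B := by
      rw [← SetLike.mem_coe, hB]
      rfl
    refine ⟨k ⟨x, hxB⟩, hD₀ (k _).2, B, D₀, hB, Set.ext fun y => ⟨fun hy => ?_, ?_⟩, k, hk⟩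
    · have h1 : k.symm ⟨y, hy⟩ = ⟨x, hxB⟩ := by
        have := (k.symm ⟨y, hy⟩).2
        rw [← SetLike.mem_coe, hB] at this
        exact Subtype.ext this
      have h2 := (Equiv.symm_apply_eq k).1 h1
      exact congrArg Subtype.val h2
    · rintro rfl
      exact (k _).2
  intro hfin
  have hcard : ∀ m : ℕ, ∀ D : ClosedBalls X, D.IsProper → D.IsInfinite →
      m ≤ ((D : Set X) ∩ {y | S.Linked x y}).ncard := by
    intro m
    induction m with
    | zero => exact fun _ _ _ => Nat.zero_le _
    | succ m ih =>
      intro D hD hD'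
      obtain ⟨B₁, B₂, hB₁, hB₂, h₁, h₂, hdisj⟩ := hstar.two_infinite_subballs D hD hD'
      have hproper : ∀ C : ClosedBalls X, (C : Set X) ⊆ D → C.IsProper := fun C hC hu =>
        hD (Set.eq_univ_of_univ_subset (hu ▸ hC))
      obtain ⟨y, hy, hxy⟩ := hmeet B₂ (hproper _ h₂) hB₂
      -- B₁ supplies m points of the class, and y in B₂ is one more.
      refine Nat.succ_le_of_lt ((ih B₁ (hproper _ h₁) hB₁).trans_lt ?_)
      refine Set.ncard_lt_ncard ⟨Set.inter_subset_inter_left _ h₁, fun hsub => ?_⟩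
        (hfin.subset Set.inter_subset_right)
      exact Set.disjoint_left.1 hdisj (hsub ⟨h₂ hy, hxy⟩).1 hy
  obtain ⟨D, hD, hD'⟩ := exists_infinite_proper_ball X
  have := hcard (((D : Set X) ∩ {y | S.Linked x y}).ncard + 1) D hD hD'
  omega

open scoped commutatorElement in
/-- If there is a finite ball, then the commutator subgroup has a nontrivial element of finite
support. -/
theorem exists_mem_finitelySupported_mem_commutator [CompactSpace X] [Infinite X] (hstar : S.IsStar)
    (hB : ∃ B : ClosedBalls X, B.IsFinite) :
    ∃ g ∈ finitelySupported S.group, g ∈ commutator S.group ∧ g ≠ 1 := by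
  classical
  obtain ⟨x, hx⟩ := exists_linked_iff_exists_isFinite (S := S).2 hB
  obtain ⟨y, hxy, hy⟩ := (infinite_linked hstar hx).exists_notMem_finite (Set.finite_singleton x)
  obtain ⟨z, hxz, hz⟩ := (infinite_linked hstar hx).exists_notMem_finite (Set.toFinite {x, y})
  simp only [Set.mem_insert_iff, Set.mem_singleton_iff, not_or] at hy hz
  obtain ⟨a, ha, ha'⟩ := exists_mem_finitelySupported (isFinitaryAlong_swap (fun _ _ h => h.symm) hxy)
  obtain ⟨b, hb, hb'⟩ := exists_mem_finitelySupported (isFinitaryAlong_swap (fun _ _ h => h.symm) hxz)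
  have := finitelySupported_normal S.group
  refine ⟨⁅a, b⁆, Subgroup.commutator_le_right (finitelySupported S.group)
    (finitelySupported S.group) (Subgroup.commutator_mem_commutator ha hb),
    Subgroup.commutator_mem_commutator (Subgroup.mem_top a) (Subgroup.mem_top b), fun h => ?_⟩
  -- If the commutator were trivial, the transpositions (x y) and (x z) would commute, but their two
  -- products send x to z and to y.
  have hab := commutatorElement_eq_one_iff_mul_comm.1 h
  have h1 : (swap x y * swap x z) x = (swap x z * swap x y) x := by
    rw [← ha', ← hb']
    exact congrArg (fun g : S.group => (g : X ≃ₜ X) x) hab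
  rw [Perm.mul_apply, Perm.mul_apply, swap_apply_left, swap_apply_left,
    swap_apply_of_ne_of_ne hz.1 hz.2, swap_apply_of_ne_of_ne hy (Ne.symm hz.2)] at h1
  exact hz.2 h1

end SimilarityStructure

/-- In a subgroup `H` with a nontrivial element of finite support, the reduced C*-algebra is not
simple. -/
theorem not_isCStarSimple_of_finitelySupported {X : Type*} [TopologicalSpace X]
    {Γ : Subgroup (X ≃ₜ X)} (H : Subgroup Γ) {g : Γ} (hgH : g ∈ H)
    (hg : g ∈ finitelySupported Γ) (hg1 : g ≠ 1) : ¬ IsCStarSimple H := by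
  have := finitelySupported_normal Γ
  refine not_isCStarSimple_of_locallyFinite (N := (finitelySupported Γ).subgroupOf H)
    (fun s hs hsN => ?_) fun hbot => hg1 ?_
  -- The inclusion of H is injective, so local finiteness may be checked in Γ.
  · refine Set.Finite.of_finite_image (f := H.subtype) ?_ H.subtype_injective.injOn
    rw [← Subgroup.coe_map, MonoidHom.map_closure]
    refine finite_closure_of_subset_finitelySupported Γ _ (hs.image _) ?_
    rintro _ ⟨h, hh, rfl⟩
    exact hsN hh
  · have : (⟨g, hgH⟩ : H) ∈ (finitelySupported Γ).subgroupOf H := hg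
    rw [hbot, Subgroup.mem_bot] at this
    exact congrArg Subtype.val this

theorem mainTheorem10 {X : Type*} [MetricSpace X] [IsUltrametricDist X] [CompactSpace X]
    [Infinite X] (S : SimilarityStructure X) (hcount : S.IsCountable) (hstar : S.IsStar) :
    (finitelySupported S.group).Normal ∧
    (∃ n : ℕ∞,
      ((∃ B : ClosedBalls X, B.IsFinite) ↔ 1 ≤ n) ∧
      Nonempty (finitelySupported S.group ≃* DirectPower SInfinity n)) ∧
    ((∃ B : ClosedBalls X, B.IsFinite) →
      ¬ IsCStarSimple S.group ∧ ¬ IsCStarSimple (commutator S.group)) := by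
  refine ⟨finitelySupported_normal _, ?_, fun hB => ?_⟩
  · obtain ⟨n, hn, Φ, hΦ, hrange⟩ := exists_directPower_hom (r := S.Linked)
      (fun _ _ h => h.symm) (fun _ _ _ h h' => h.trans h')
      SimilarityStructure.countable_linked
      (fun _ => SimilarityStructure.infinite_linked hstar)
    refine ⟨n, SimilarityStructure.exists_linked_iff_exists_isFinite.symm.trans hn, ⟨?_⟩⟩
    -- Both groups embed in the permutations of X with the same image, the finitary permutations
    -- along `Linked`.
    have heq : S.finitelySupportedToPerm.range = Φ.range := Subgroup.ext fun σ => by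
      rw [hrange, SimilarityStructure.mem_range_finitelySupportedToPerm]
    exact (MonoidHom.ofInjective SimilarityStructure.finitelySupportedToPerm_injective).trans
      ((MulEquiv.subgroupCongr heq).trans (MonoidHom.ofInjective hΦ).symm)
  · obtain ⟨g, hg, hg', hg1⟩ :=
      SimilarityStructure.exists_mem_finitelySupported_mem_commutator hstar hB
    have := finitelySupported_normal S.group
    refine ⟨not_isCStarSimple_of_locallyFinite (N := finitelySupported S.group)
      (finite_closure_of_subset_finitelySupported _) fun h => hg1 ?_,
      not_isCStarSimple_of_finitelySupported _ hg' hg hg1⟩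
    rw [h] at hg
    exact Subgroup.mem_bot.1 hg
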